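/- **Theorem (Barr's theorem, simple version).** Let $\mathbb{T}$ be a geometric theory and let $\sigma$ be a geometric sequent over the signature of $\mathbb{T}$. Then the following statements are equivalent. 1. There is a $\mathbb{T}$-derivation of $\sigma$ in geometric logic. 2. There is a $\mathbb{T}$-derivation of $\sigma$ in infinitary intuitionistic first-order logic. 3. There is a $\mathbb{T}$-derivation of $\sigma$ in infinitary classical first-order logic. Here the following terminology is used. A signature consists of a set of sorts, a set of function symbols $f : X_1 \times \cdots \times X_n \to Y$ and a set of relation symbols $R \hookrightarrow X_1 \times \cdots \times X_n$ ($n \geq 0$). The infinitary first-order formulas in a finite context $\vec x = (x_1{:}X_1, \ldots, x_n{:}X_n)$ are built from equations between terms of the same sort and from relation symbols applied to terms by means of $\top, \bot, \wedge, \vee, \Rightarrow$, disjunctions $\bigvee_{i \in I}$ and conjunctions $\bigwedge_{i \in I}$ of arbitrary set-indexed families of formulas (in the same context), $\exists$ and $\forall$; $\neg\varphi$ abbreviates $\varphi \Rightarrow \bot$. A formula is geometric if it is built without $\Rightarrow$, $\bigwedge_{i\in I}$ and $\forall$. A sequent $\varphi \vdash_{\vec x} \psi$ consists of a context $\vec x$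 and two formulas $\varphi, \psi$ in this context; it is geometric if $\varphi$ and $\psi$ are geometric. A geometric theory consists of a signature and a collection of geometric sequents over it, its axioms. A $\mathbb{T}$-derivation in geometric logic is a derivation, in which only geometric formulas occur, from the axioms of $\mathbb{T}$ by the following rules. * Structural rules: $\varphi \vdash_{\vec x} \varphi$; from $\varphi \vdash_{\vec x} \psi$ and $\psi \vdash_{\vec x} \chi$ infer $\varphi \vdash_{\vec x} \chi$; from $\varphi \vdash_{\vec x} \psi$ infer $\varphi[\vec s/\vec x] \vdash_{\vec y} \psi[\vec s/\vec x]$, for terms $\vec s$ in the context $\vec y$ (capture-avoiding substitution). * Conjunction: $\varphi \vdash_{\vec x} \top$; $\varphi \wedge \psi \vdash_{\vec x} \varphi$; $\varphi \wedge \psi \vdash_{\vec x} \psi$; from $\varphi \vdash_{\vec x} \psi$ and $\varphi \vdash_{\vec x} \chi$ infer $\varphi \vdash_{\vec x} \psi \wedge \chi$. * Finitary disjunction: $\bot \vdash_{\vec x} \varphi$; $\varphi \vdash_{\vec x} \varphi \vee \psi$; $\psi \vdash_{\vec x} \varphi \vee \psi$; from $\varphi \vdash_{\vec x} \chi$ and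 $\psi \vdash_{\vec x} \chi$ infer $\varphi \vee \psi \vdash_{\vec x} \chi$. * Infinitary disjunction: $\varphi_{i_0} \vdash_{\vec x} \bigvee_{i \in I} \varphi_i$; from $\varphi_i \vdash_{\vec x} \chi$ for each $i \in I$ infer $\bigvee_{i\in I} \varphi_i \vdash_{\vec x} \chi$. * Existential quantification: from $\varphi \vdash_{\vec x, y} \psi$ infer $(\exists y{:}Y.\ \varphi) \vdash_{\vec x} \psi$, and conversely ($y$ not free in $\psi$). * Mixed rules: $(\bigvee_i \varphi_i) \wedge \psi \vdash_{\vec x} \bigvee_i (\varphi_i \wedge \psi)$; $(\exists y{:}Y.\ \varphi) \wedge \psi \vdash_{\vec x} \exists y{:}Y.\ (\varphi \wedge \psi)$ ($y$ none of the $\vec x$). * Equality: $\top \vdash_{x} x = x$; $(\vec x = \vec y) \wedge \varphi \vdash_{\vec z} \varphi[\vec y/\vec x]$, for tuples of variables $\vec x, \vec y$ of the context $\vec z$ of the same length and the same sorts, the entries of $\vec x$ being distinct. A $\mathbb{T}$-derivation in infinitary intuitionistic first-order logic is a derivation, in which all infinitary first-order formulas may occur, from the axioms of $\mathbb{T}$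 by the rules above and the following ones. * Infinitary conjunction: $\bigwedge_{i \in I} \varphi_i \vdash_{\vec x} \varphi_{i_0}$; from $\psi \vdash_{\vec x} \varphi_i$ for each $i \in I$ infer $\psi \vdash_{\vec x} \bigwedge_{i \in I} \varphi_i$. * Implication: from $\varphi \wedge \psi \vdash_{\vec x} \chi$ infer $\varphi \vdash_{\vec x} \psi \Rightarrow \chi$, and conversely. * Universal quantification: from $\varphi \vdash_{\vec x, y} \psi$ infer $\varphi \vdash_{\vec x} \forall y{:}Y.\ \psi$, and conversely ($y$ not free in $\varphi$). Infinitary classical first-order logic has in addition the law of excluded middle, $\top \vdash_{\vec x} \varphi \vee \neg\varphi$ for every infinitary first-order formula $\varphi$ in the context $\vec x$. -/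

import Mathlib

universe u

namespace GeometricLogic

/-- A many-sorted signature: a set of sorts, for every list of sorts `X₁, …, Xₙ` and every sort `Y`
the set of function symbols `X₁ × ⋯ × Xₙ → Y`, and for every list of sorts `X₁, …, Xₙ` the set of
relation symbols `R ↪ X₁ × ⋯ × Xₙ`. "Set" is rendered by "type in the universe `u`". -/
structure Signature where
  /-- the sorts -/
  Srt : Type u
  /-- the function symbols with given domain and codomain -/
  Func : List Srt → Srt → Type u
  /-- the relation symbols of given arity -/
  Rel : List Srt → Type u

/-- A context `x₁ : X₁, …, xₙ : Xₙ`. Variables are nameless (de Bruijn), so a context is the finite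
list of the sorts of its variables; the variable that was added last is the head of the list. -/
abbrev Ctx (S : Signature.{u}) : Type u := List S.Srt

/-- `Var Γ s`: the variables of sort `s` in the context `Γ`, that is the positions of `Γ` that hold
the sort `s`. -/
inductive Var {S : Signature.{u}} : Ctx S → S.Srt → Type u
  | zero {Γ : Ctx S} {s : S.Srt} : Var (s :: Γ) s
  | succ {Γ : Ctx S} {s t : S.Srt} (v : Var Γ s) : Var (t :: Γ) s

/-- `Term S Γ s`: the terms of sort `s` in the context `Γ`. -/
inductive Term (S : Signature.{u}) (Γ : Ctx S) : S.Srt → Type u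
  | var {s : S.Srt} (v : Var Γ s) : Term S Γ s
  | app {D : List S.Srt} {s : S.Srt} (f : S.Func D s) (a : ∀ t : S.Srt, Var D t → Term S Γ t) :
      Term S Γ s

variable {S : Signature.{u}}

/-- A tuple of terms in the context `Δ`, one for every entry of the list `Γ` and of the
corresponding sort. -/
abbrev Subst (Γ Δ : Ctx S) : Type u := ∀ s : S.Srt, Var Γ s → Term S Δ s

/-- Simultaneous substitution in terms. -/
def Term.subst {Γ Δ : Ctx S} (σ : Subst Γ Δ) : ∀ {s : S.Srt}, Term S Γ s → Term S Δ s
  | _, .var v => σ _ v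
  | _, .app f a => .app f (fun t v => (a t v).subst σ)

/-- The substitution that regards objects in context `Γ` as objects in context `Γ, x : s`. -/
def Subst.wk (Γ : Ctx S) (s : S.Srt) : Subst Γ (s :: Γ) := fun _ v => .var v.succ

/-- The extension of a substitution under a binder. -/
def Subst.lift {Γ Δ : Ctx S} (σ : Subst Γ Δ) (s : S.Srt) : Subst (s :: Γ) (s :: Δ)
  | _, .zero => .var .zero
  | _, .succ v => (σ _ v).subst (Subst.wk Δ s)

/-- `Formula S Γ`: the infinitary first-order formulas over `S` in the context `Γ`, built from
equations and relation symbols with `⊤`, `⊥`, `∧`, `∨`, `⇒`, set-indexed disjunctions and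
conjunctions, `∃` and `∀`. -/
inductive Formula (S : Signature.{u}) : Ctx S → Type (u + 1)
  | eq {Γ : Ctx S} {s : S.Srt} (a b : Term S Γ s) : Formula S Γ
  | rel {Γ : Ctx S} {D : List S.Srt} (R : S.Rel D) (a : ∀ t : S.Srt, Var D t → Term S Γ t) :
      Formula S Γ
  | top {Γ : Ctx S} : Formula S Γ
  | bot {Γ : Ctx S} : Formula S Γ
  | and {Γ : Ctx S} (φ ψ : Formula S Γ) : Formula S Γ
  | or {Γ : Ctx S} (φ ψ : Formula S Γ) : Formula S Γ
  | imp {Γ : Ctx S} (φ ψ : Formula S Γ) : Formula S Γ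
  | iOr {Γ : Ctx S} {I : Type u} (φ : I → Formula S Γ) : Formula S Γ
  | iAnd {Γ : Ctx S} {I : Type u} (φ : I → Formula S Γ) : Formula S Γ
  | ex {Γ : Ctx S} {s : S.Srt} (φ : Formula S (s :: Γ)) : Formula S Γ
  | all {Γ : Ctx S} {s : S.Srt} (φ : Formula S (s :: Γ)) : Formula S Γ

namespace Formula

/-- Negation is implication to `⊥`. -/
def neg {Γ : Ctx S} (φ : Formula S Γ) : Formula S Γ := imp φ bot

/-- Simultaneous (capture-avoiding) substitution `φ[σ]`. -/
def subst : ∀ {Γ Δ : Ctx S}, Formula S Γ → Subst Γ Δ → Formula S Δ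
  | _, _, eq a b, σ => eq (a.subst σ) (b.subst σ)
  | _, _, rel R a, σ => rel R (fun t v => (a t v).subst σ)
  | _, _, top, _ => top
  | _, _, bot, _ => bot
  | _, _, and φ ψ, σ => and (φ.subst σ) (ψ.subst σ)
  | _, _, or φ ψ, σ => or (φ.subst σ) (ψ.subst σ)
  | _, _, imp φ ψ, σ => imp (φ.subst σ) (ψ.subst σ)
  | _, _, iOr φ, σ => iOr (fun i => (φ i).subst σ)
  | _, _, iAnd φ, σ => iAnd (fun i => (φ i).subst σ)
  | _, _, ex φ, σ => ex (φ.subst (σ.lift _))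
  | _, _, all φ, σ => all (φ.subst (σ.lift _))

/-- A formula over `Γ`, regarded as a formula over `Γ, x : s` in which `x` is not free. -/
def wk {Γ : Ctx S} (s : S.Srt) (φ : Formula S Γ) : Formula S (s :: Γ) := φ.subst (Subst.wk Γ s)

/-- The geometric formulas: those built without `⇒`, set-indexed conjunction and `∀`. -/
def IsGeometric : ∀ {Γ : Ctx S}, Formula S Γ → Prop
  | _, eq _ _ => True
  | _, rel _ _ => True
  | _, top => True
  | _, bot => True
  | _, and φ ψ => φ.IsGeometric ∧ ψ.IsGeometric
  | _, or φ ψ => φ.IsGeometric ∧ ψ.IsGeometric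
  | _, imp _ _ => False
  | _, iOr φ => ∀ i, (φ i).IsGeometric
  | _, iAnd _ => False
  | _, ex φ => φ.IsGeometric
  | _, all _ => False

/-- For a list `x₁, …, xₙ` of variables and an assignment `ρ` of variables to variables, the formula
`x₁ = ρ(x₁) ∧ ⋯ ∧ xₙ = ρ(xₙ)`. -/
def varEqs {Γ : Ctx S} (ρ : ∀ s : S.Srt, Var Γ s → Var Γ s) :
    List (Σ s : S.Srt, Var Γ s) → Formula S Γ
  | [] => top
  | x :: xs => and (eq (.var x.2) (.var (ρ x.1 x.2))) (varEqs ρ xs)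

end Formula

/-- A sequent `φ ⊢ ψ` in a context. -/
structure Sequent (S : Signature.{u}) where
  /-- the context -/
  ctx : Ctx S
  /-- the formula on the left -/
  lhs : Formula S ctx
  /-- the formula on the right -/
  rhs : Formula S ctx

/-- A sequent is geometric if both of its formulas are. -/
def Sequent.IsGeometric (σ : Sequent S) : Prop := σ.lhs.IsGeometric ∧ σ.rhs.IsGeometric

/-- A geometric theory over the signature `S`: its axioms are geometric sequents. -/
structure GeometricTheory (S : Signature.{u}) where
  /-- the axioms -/
  axioms : Set (Sequent S)
  /-- the axioms are geometric sequents -/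
  geometric : ∀ σ ∈ axioms, σ.IsGeometric

/-- The three logics. -/
inductive Logic
  | geometric
  | intuitionistic
  | classical

/-- `L.Admits φ`: `φ` is a formula of the logic `L`. The formulas of geometric logic are the
geometric ones; the other two logics have all infinitary first-order formulas. -/
def Logic.Admits (L : Logic) {Γ : Ctx S} (φ : Formula S Γ) : Prop :=
  match L with
  | .geometric => φ.IsGeometric
  | .intuitionistic => True
  | .classical => True

/-- `Derivable T L φ ψ`, for `φ` and `ψ` in the context `Γ`: the sequent `φ ⊢ ψ` in context `Γ` has
a derivation from the axioms of `T` in the logic `L`. In geometric logic only geometric formulas may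
occur in a derivation. The rules for set-indexed conjunction, `⇒` and `∀` belong to intuitionistic
and classical logic only, and the law of excluded middle belongs to classical logic only. -/
inductive Derivable (T : GeometricTheory S) (L : Logic) :
    ∀ {Γ : Ctx S}, Formula S Γ → Formula S Γ → Prop
  -- axioms of the theory
  | ax (σ : Sequent S) (hσ : σ ∈ T.axioms) : Derivable T L σ.lhs σ.rhs
  -- structural rules
  | refl {Γ : Ctx S} {φ : Formula S Γ} (hφ : L.Admits φ) : Derivable T L φ φ
  | cut {Γ : Ctx S} {φ ψ χ : Formula S Γ} (h₁ : Derivable T L φ ψ) (h₂ : Derivable T L ψ χ) :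
      Derivable T L φ χ
  | subst {Γ Δ : Ctx S} {φ ψ : Formula S Γ} (σ : Subst Γ Δ) (h : Derivable T L φ ψ) :
      Derivable T L (φ.subst σ) (ψ.subst σ)
  -- conjunction
  | topI {Γ : Ctx S} {φ : Formula S Γ} (hφ : L.Admits φ) : Derivable T L φ .top
  | andL {Γ : Ctx S} {φ ψ : Formula S Γ} (hφ : L.Admits φ) (hψ : L.Admits ψ) :
      Derivable T L (.and φ ψ) φ
  | andR {Γ : Ctx S} {φ ψ : Formula S Γ} (hφ : L.Admits φ) (hψ : L.Admits ψ) :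
      Derivable T L (.and φ ψ) ψ
  | andI {Γ : Ctx S} {φ ψ χ : Formula S Γ} (h₁ : Derivable T L φ ψ) (h₂ : Derivable T L φ χ) :
      Derivable T L φ (.and ψ χ)
  -- finitary disjunction
  | botE {Γ : Ctx S} {φ : Formula S Γ} (hφ : L.Admits φ) : Derivable T L .bot φ
  | orL {Γ : Ctx S} {φ ψ : Formula S Γ} (hφ : L.Admits φ) (hψ : L.Admits ψ) :
      Derivable T L φ (.or φ ψ)
  | orR {Γ : Ctx S} {φ ψ : Formula S Γ} (hφ : L.Admits φ) (hψ : L.Admits ψ) :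
      Derivable T L ψ (.or φ ψ)
  | orE {Γ : Ctx S} {φ ψ χ : Formula S Γ} (h₁ : Derivable T L φ χ) (h₂ : Derivable T L ψ χ) :
      Derivable T L (.or φ ψ) χ
  -- infinitary disjunction
  | iOrI {Γ : Ctx S} {I : Type u} {φ : I → Formula S Γ} (hφ : ∀ i, L.Admits (φ i)) (i₀ : I) :
      Derivable T L (φ i₀) (.iOr φ)
  | iOrE {Γ : Ctx S} {I : Type u} {φ : I → Formula S Γ} {χ : Formula S Γ} (hχ : L.Admits χ)
      (h : ∀ i, Derivable T L (φ i) χ) : Derivable T L (.iOr φ) χ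
  -- existential quantification (double rule)
  | exE {Γ : Ctx S} {s : S.Srt} {φ : Formula S (s :: Γ)} {ψ : Formula S Γ} (hψ : L.Admits ψ)
      (h : Derivable T L φ (ψ.wk s)) : Derivable T L (.ex φ) ψ
  | exI {Γ : Ctx S} {s : S.Srt} {φ : Formula S (s :: Γ)} {ψ : Formula S Γ}
      (h : Derivable T L (.ex φ) ψ) : Derivable T L φ (ψ.wk s)
  -- mixed rules
  | iOrDistrib {Γ : Ctx S} {I : Type u} {φ : I → Formula S Γ} {ψ : Formula S Γ}
      (hφ : ∀ i, L.Admits (φ i)) (hψ : L.Admits ψ) :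
      Derivable T L (.and (.iOr φ) ψ) (.iOr (fun i => .and (φ i) ψ))
  | exDistrib {Γ : Ctx S} {s : S.Srt} {φ : Formula S (s :: Γ)} {ψ : Formula S Γ}
      (hφ : L.Admits φ) (hψ : L.Admits ψ) :
      Derivable T L (.and (.ex φ) ψ) (.ex (.and φ (ψ.wk s)))
  -- equality: `⊤ ⊢ x = x` in the context `x : s`, and `(x⃗ = y⃗) ∧ φ ⊢ φ[y⃗/x⃗]`, where `y⃗ = ρ(x⃗)` and
  -- `ρ` fixes all variables that are not among the `x⃗`
  | eqRefl (s : S.Srt) :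
      Derivable T L (Γ := [s]) .top (.eq (.var (Var.zero (s := s))) (.var Var.zero))
  | eqSubst {Γ : Ctx S} {φ : Formula S Γ} (hφ : L.Admits φ) (x : List (Σ s : S.Srt, Var Γ s))
      (ρ : ∀ s : S.Srt, Var Γ s → Var Γ s) (hρ : ∀ s v, ⟨s, v⟩ ∉ x → ρ s v = v) :
      Derivable T L (.and (Formula.varEqs ρ x) φ) (φ.subst (fun s v => .var (ρ s v)))
  -- infinitary conjunction
  | iAndE (hL : L ≠ .geometric) {Γ : Ctx S} {I : Type u} {φ : I → Formula S Γ} (i₀ : I) :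
      Derivable T L (.iAnd φ) (φ i₀)
  | iAndI (hL : L ≠ .geometric) {Γ : Ctx S} {I : Type u} {φ : I → Formula S Γ} {ψ : Formula S Γ}
      (h : ∀ i, Derivable T L ψ (φ i)) : Derivable T L ψ (.iAnd φ)
  -- implication (double rule)
  | impI (hL : L ≠ .geometric) {Γ : Ctx S} {φ ψ χ : Formula S Γ}
      (h : Derivable T L (.and φ ψ) χ) : Derivable T L φ (.imp ψ χ)
  | impE (hL : L ≠ .geometric) {Γ : Ctx S} {φ ψ χ : Formula S Γ}
      (h : Derivable T L φ (.imp ψ χ)) : Derivable T L (.and φ ψ) χ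
  -- universal quantification (double rule)
  | allI (hL : L ≠ .geometric) {Γ : Ctx S} {s : S.Srt} {φ : Formula S Γ} {ψ : Formula S (s :: Γ)}
      (h : Derivable T L (φ.wk s) ψ) : Derivable T L φ (.all ψ)
  | allE (hL : L ≠ .geometric) {Γ : Ctx S} {s : S.Srt} {φ : Formula S Γ} {ψ : Formula S (s :: Γ)}
      (h : Derivable T L φ (.all ψ)) : Derivable T L (φ.wk s) ψ
  -- law of excluded middle
  | lem (hL : L = .classical) {Γ : Ctx S} (φ : Formula S Γ) :
      Derivable T L .top (.or φ φ.neg)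

/-- There is a `T`-derivation of the sequent `σ` in the logic `L`. -/
def GeometricTheory.Derives (T : GeometricTheory S) (L : Logic) (σ : Sequent S) : Prop :=
  Derivable T L σ.lhs σ.rhs

end GeometricLogic

/-! The implications 1 → 2 → 3 only reread a derivation in a stronger logic (`Derivable.mono`). For
3 → 1, classical logic is interpreted in a forcing semantics built from geometric derivations. A
condition is a geometric hypothesis with a geometric goal; refinements substitute terms, strengthen
the hypothesis and carry the goal along. `⊥` is read as "the hypothesis proves the goal", and atoms,
disjunctions and `∃` are closed under double negation relative to this reading of `⊥`. Hence
excluded middle is forced, and classical derivations are sound (`Derivable.forces`).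

The semantics is faithful on geometric formulas: being forced means being locally entailed by the
hypothesis (`forces_iff_locally_entails`). This makes the axioms of `T` sound. Apply soundness to
the condition with hypothesis `φ` and goal `ψ`: it forces `φ`, hence `ψ`, so `ψ` is locally
entailed. A refinement entailing its instance of `ψ` proves its own goal, and the relative double
negation then yields `φ ⊢ ψ` itself. -/

namespace GeometricLogic

/-! ### Calculus of substitutions. -/

section Substitution

variable {S : Signature.{u}}

/-- The identity substitution. -/
def Subst.id (Γ : Ctx S) : Subst Γ Γ := fun _ v => .var v

/-- Composition of substitutions. -/
def Subst.comp {Γ Δ Θ : Ctx S} (σ : Subst Γ Δ) (τ : Subst Δ Θ) : Subst Γ Θ :=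
  fun _ v => (σ _ v).subst τ

/-- Extension of a substitution by a term. -/
def Subst.cons {Γ Δ : Ctx S} {s : S.Srt} (t : Term S Δ s) (σ : Subst Γ Δ) : Subst (s :: Γ) Δ
  | _, .zero => t
  | _, .succ v => σ _ v

theorem Term.subst_id {Γ : Ctx S} {s : S.Srt} (a : Term S Γ s) : a.subst (Subst.id Γ) = a := by
  induction a with
  | var v => rfl
  | app f a ih => simp only [Term.subst, ih]

theorem Term.subst_subst {Γ Δ Θ : Ctx S} (σ : Subst Γ Δ) (τ : Subst Δ Θ) {s : S.Srt}
    (a : Term S Γ s) : (a.subst σ).subst τ = a.subst (σ.comp τ) := by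
  induction a with
  | var v => rfl
  | app f a ih => simp only [Term.subst, ih]

theorem Subst.comp_id {Γ Δ : Ctx S} (σ : Subst Γ Δ) : σ.comp (Subst.id Δ) = σ := by
  funext s v; exact Term.subst_id _

theorem Subst.comp_assoc {Γ Δ Θ Ξ : Ctx S} (σ : Subst Γ Δ) (τ : Subst Δ Θ) (υ : Subst Θ Ξ) :
    (σ.comp τ).comp υ = σ.comp (τ.comp υ) := by
  funext s v; exact Term.subst_subst _ _ _

theorem Subst.cons_comp {Γ Δ Θ : Ctx S} {s : S.Srt} (t : Term S Δ s) (σ : Subst Γ Δ)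
    (τ : Subst Δ Θ) : (Subst.cons t σ).comp τ = Subst.cons (t.subst τ) (σ.comp τ) := by
  funext r v; cases v <;> rfl

theorem Subst.wk_comp_cons {Γ Δ : Ctx S} {s : S.Srt} (t : Term S Δ s) (σ : Subst Γ Δ) :
    (Subst.wk Γ s).comp (Subst.cons t σ) = σ := rfl

theorem Subst.cons_eta {Γ Δ : Ctx S} {s : S.Srt} (σ : Subst (s :: Γ) Δ) :
    Subst.cons (σ _ .zero) ((Subst.wk Γ s).comp σ) = σ := by
  funext r v; cases v <;> rfl

/-- Reduces the laws for binders to those of `cons` and `wk`. -/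
theorem Subst.lift_eq_cons {Γ Δ : Ctx S} (σ : Subst Γ Δ) (s : S.Srt) :
    σ.lift s = Subst.cons (.var .zero) (σ.comp (Subst.wk Δ s)) := by
  funext r v; cases v <;> rfl

theorem Subst.lift_comp_cons {Γ Δ Θ : Ctx S} (σ : Subst Γ Δ) {s : S.Srt} (t : Term S Θ s)
    (τ : Subst Δ Θ) : (σ.lift s).comp (Subst.cons t τ) = Subst.cons t (σ.comp τ) := by
  rw [Subst.lift_eq_cons, Subst.cons_comp, Subst.comp_assoc, Subst.wk_comp_cons]; rfl

theorem Subst.lift_comp_lift {Γ Δ Θ : Ctx S} (σ : Subst Γ Δ) (τ : Subst Δ Θ) (s : S.Srt) :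
    (σ.lift s).comp (τ.lift s) = (σ.comp τ).lift s := by
  rw [Subst.lift_eq_cons τ, Subst.lift_comp_cons, Subst.lift_eq_cons, Subst.comp_assoc]

theorem Subst.lift_id (Γ : Ctx S) (s : S.Srt) : (Subst.id Γ).lift s = Subst.id (s :: Γ) := by
  funext r v; cases v <;> rfl

namespace Formula

theorem subst_id {Γ : Ctx S} (φ : Formula S Γ) : φ.subst (Subst.id Γ) = φ := by
  induction φ <;> simp_all only [subst, Term.subst_id, Subst.lift_id]

theorem subst_subst {Γ Δ Θ : Ctx S} (φ : Formula S Γ) (σ : Subst Γ Δ) (τ : Subst Δ Θ) :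
    (φ.subst σ).subst τ = φ.subst (σ.comp τ) := by
  induction φ generalizing Δ Θ <;>
    simp_all only [subst, Term.subst_subst, Subst.lift_comp_lift]

theorem IsGeometric.subst {Γ Δ : Ctx S} {φ : Formula S Γ} (h : φ.IsGeometric) (σ : Subst Γ Δ) :
    (φ.subst σ).IsGeometric := by
  induction φ generalizing Δ with
  | eq | rel | top | bot => trivial
  | and φ ψ ihφ ihψ => exact ⟨ihφ h.1 σ, ihψ h.2 σ⟩
  | or φ ψ ihφ ihψ => exact ⟨ihφ h.1 σ, ihψ h.2 σ⟩
  | iOr φ ih => exact fun i => ih i (h i) σ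
  | ex φ ih => exact ih h _
  | imp | iAnd | all => exact h.elim

theorem isGeometric_varEqs {Γ : Ctx S} (ρ : ∀ s : S.Srt, Var Γ s → Var Γ s)
    (x : List (Σ s : S.Srt, Var Γ s)) : (varEqs ρ x).IsGeometric := by
  induction x with
  | nil => trivial
  | cons _ _ ih => exact ⟨trivial, ih⟩

end Formula

/-- Finiteness of contexts, which lets `subst_congr` treat one variable at a time. -/
theorem Var.exists_list (Γ : Ctx S) :
    ∃ x : List (Σ s : S.Srt, Var Γ s), ∀ s v, (⟨s, v⟩ : Σ s : S.Srt, Var Γ s) ∈ x := by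
  induction Γ with
  | nil => exact ⟨[], fun _ v => nomatch v⟩
  | cons t Γ ih =>
    obtain ⟨x, hx⟩ := ih
    refine ⟨⟨t, .zero⟩ :: x.map (fun p => ⟨p.1, p.2.succ⟩), fun s v => ?_⟩
    cases v with
    | zero => exact List.mem_cons_self
    | succ v => exact List.mem_cons_of_mem _ (List.mem_map.2 ⟨⟨s, v⟩, hx s v, rfl⟩)

end Substitution

/-! ### Derived rules of geometric logic. -/

section Derivations

variable {S : Signature.{u}} {T : GeometricTheory S} {Γ Δ : Ctx S}

theorem Logic.Admits.of_ne {L : Logic} (hL : L ≠ .geometric) (φ : Formula S Γ) : L.Admits φ := by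
  cases L
  · exact absurd rfl hL
  · trivial
  · trivial

/-- Derivations may be read in a stronger logic. -/
theorem Derivable.mono {L L' : Logic} (hL : L' ≠ .geometric)
    (hc : L = .classical → L' = .classical) {φ ψ : Formula S Γ} (h : Derivable T L φ ψ) :
    Derivable T L' φ ψ := by
  induction h with
  | ax σ hσ => exact .ax σ hσ
  | refl => exact .refl (.of_ne hL _)
  | cut _ _ h₁ h₂ => exact .cut h₁ h₂
  | subst σ _ h => exact .subst σ h
  | topI => exact .topI (.of_ne hL _)
  | andL => exact .andL (.of_ne hL _) (.of_ne hL _)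
  | andR => exact .andR (.of_ne hL _) (.of_ne hL _)
  | andI _ _ h₁ h₂ => exact .andI h₁ h₂
  | botE => exact .botE (.of_ne hL _)
  | orL => exact .orL (.of_ne hL _) (.of_ne hL _)
  | orR => exact .orR (.of_ne hL _) (.of_ne hL _)
  | orE _ _ h₁ h₂ => exact .orE h₁ h₂
  | iOrI _ i => exact .iOrI (fun _ => .of_ne hL _) i
  | iOrE _ _ h => exact .iOrE (.of_ne hL _) h
  | exE _ _ h => exact .exE (.of_ne hL _) h
  | exI _ h => exact .exI h
  | iOrDistrib => exact .iOrDistrib (fun _ => .of_ne hL _) (.of_ne hL _)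
  | exDistrib => exact .exDistrib (.of_ne hL _) (.of_ne hL _)
  | eqRefl s => exact .eqRefl s
  | eqSubst _ x ρ hρ => exact .eqSubst (.of_ne hL _) x ρ hρ
  | iAndE _ i => exact .iAndE hL i
  | iAndI _ _ h => exact .iAndI hL h
  | impI _ _ h => exact .impI hL h
  | impE _ _ h => exact .impE hL h
  | allI _ _ h => exact .allI hL h
  | allE _ _ h => exact .allE hL h
  | lem h φ => exact .lem (hc h) φ

/-- Derivability in geometric logic. -/
abbrev GeomDerivable (T : GeometricTheory S) (φ ψ : Formula S Γ) : Prop :=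
  Derivable T .geometric φ ψ

namespace GeomDerivable

theorem and_swap {φ ψ : Formula S Γ} (hφ : φ.IsGeometric) (hψ : ψ.IsGeometric) :
    GeomDerivable T (.and φ ψ) (.and ψ φ) :=
  .andI (.andR hφ hψ) (.andL hφ hψ)

/-- Without `⇒` a side hypothesis `χ` cannot be moved to the right, so elimination under `χ` relies
on the mixed rules. -/
theorem iOr_cases {χ α : Formula S Γ} {I : Type u} {φ : I → Formula S Γ} (hχ : χ.IsGeometric)
    (hα : α.IsGeometric) (hφ : ∀ i, (φ i).IsGeometric)
    (h : ∀ i, GeomDerivable T (.and χ (φ i)) α) : GeomDerivable T (.and χ (.iOr φ)) α :=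
  .cut (and_swap hχ hφ) (.cut (.iOrDistrib hφ hχ)
    (.iOrE hα fun i => .cut (and_swap (hφ i) hχ) (h i)))

theorem or_cases {χ α φ ψ : Formula S Γ} (hχ : χ.IsGeometric) (hα : α.IsGeometric)
    (hφ : φ.IsGeometric) (hψ : ψ.IsGeometric) (h₁ : GeomDerivable T (.and χ φ) α)
    (h₂ : GeomDerivable T (.and χ ψ) α) : GeomDerivable T (.and χ (.or φ ψ)) α := by
  -- The mixed rule covers only set-indexed disjunctions, so `φ ∨ ψ` is replaced by one over two
  -- indices.
  let f : ULift.{u} Bool → Formula S Γ := fun b => if b.down then φ else ψ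
  have hf : ∀ b, (f b).IsGeometric := by rintro ⟨_ | _⟩ <;> assumption
  have key : GeomDerivable T (.or φ ψ) (.iOr f) :=
    .orE (.iOrI (L := .geometric) (φ := f) hf ⟨true⟩)
      (.iOrI (L := .geometric) (φ := f) hf ⟨false⟩)
  refine .cut (.andI (.andL hχ ⟨hφ, hψ⟩) (.cut (.andR hχ ⟨hφ, hψ⟩) key))
    (iOr_cases hχ hα hf ?_)
  rintro ⟨_ | _⟩ <;> assumption

theorem ex_cases {s : S.Srt} {χ α : Formula S Γ} {φ : Formula S (s :: Γ)} (hχ : χ.IsGeometric)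
    (hα : α.IsGeometric) (hφ : φ.IsGeometric)
    (h : GeomDerivable T (.and (χ.wk s) φ) (α.wk s)) : GeomDerivable T (.and χ (.ex φ)) α :=
  .cut (and_swap hχ hφ) (.cut (.exDistrib hφ hχ)
    (.exE hα (.cut (and_swap hφ (hχ.subst _)) h)))

theorem ex_intro {s : S.Srt} {φ : Formula S (s :: Γ)} (hφ : φ.IsGeometric) (t : Term S Γ s) :
    GeomDerivable T (φ.subst (Subst.cons t (Subst.id Γ))) (.ex φ) := by
  have h : GeomDerivable T φ (Formula.wk s (.ex φ)) := .exI (.refl (L := .geometric) hφ)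
  have h' := Derivable.subst (Subst.cons t (Subst.id Γ)) h
  rwa [Formula.wk, Formula.subst_subst, Subst.wk_comp_cons, Formula.subst_id] at h'

theorem eq_refl {s : S.Srt} {χ : Formula S Γ} (hχ : χ.IsGeometric) (a : Term S Γ s) :
    GeomDerivable T χ (.eq a a) :=
  .cut (.topI hχ)
    (Derivable.subst (Subst.cons a (show Subst [] Γ from fun _ v => nomatch v)) (Derivable.eqRefl (T := T) s))

/-- Replacement of equals by equals in one variable. -/
theorem eq_replace {s : S.Srt} {χ : Formula S Γ} {ψ : Formula S (s :: Γ)} (hχ : χ.IsGeometric)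
    (hψ : ψ.IsGeometric) {a b : Term S Γ s} (hab : GeomDerivable T χ (.eq a b))
    (h : GeomDerivable T χ (ψ.subst (Subst.cons a (Subst.id Γ)))) :
    GeomDerivable T χ (ψ.subst (Subst.cons b (Subst.id Γ))) := by
  -- The equality rule replaces variables by variables. It is applied to two fresh variables, `ρ`
  -- sending the first to the second, which are then instantiated by `a` and `b`.
  let ρ : ∀ t : S.Srt, Var (s :: s :: Γ) t → Var (s :: s :: Γ) t := fun
    | _, .zero => .succ .zero
    | _, .succ v => .succ v
  let ι : Subst (s :: Γ) (s :: s :: Γ) :=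
    Subst.cons (.var .zero) ((Subst.wk Γ s).comp (Subst.wk (s :: Γ) s))
  have key := Derivable.subst (Subst.cons a (Subst.cons b (Subst.id Γ)))
    (Derivable.eqSubst (T := T) (L := .geometric) (φ := ψ.subst ι) (hψ.subst ι) [⟨s, .zero⟩] ρ
      (by
        intro t v hv
        cases v with
        | zero => exact absurd List.mem_cons_self hv
        | succ v => rfl))
  have e₁ : ι.comp (Subst.cons a (Subst.cons b (Subst.id Γ))) = Subst.cons a (Subst.id Γ) := by
    funext r v; cases v <;> rfl
  have e₂ : (ι.comp fun _ v => .var (ρ _ v)).comp (Subst.cons a (Subst.cons b (Subst.id Γ))) =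
      Subst.cons b (Subst.id Γ) := by
    funext r v; cases v <;> rfl
  simp only [Formula.subst, Formula.varEqs, Formula.subst_subst, e₁] at key
  rw [e₂] at key
  exact .cut (.andI (.andI hab (.topI hχ)) h) key

/-- Replacement in `x = a`, starting from `a = a`. -/
theorem eq_symm {s : S.Srt} {χ : Formula S Γ} (hχ : χ.IsGeometric) {a b : Term S Γ s}
    (hab : GeomDerivable T χ (.eq a b)) : GeomDerivable T χ (.eq b a) := by
  have e : ∀ c : Term S Γ s,
      Formula.subst (.eq (.var .zero) (a.subst (Subst.wk Γ s))) (Subst.cons c (Subst.id Γ)) =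
        .eq c a := by
    intro c
    simp only [Formula.subst, Term.subst_subst, Subst.wk_comp_cons, Term.subst_id]; rfl
  have := eq_replace (T := T) (ψ := .eq (.var .zero) (a.subst (Subst.wk Γ s))) hχ trivial hab
    (by rw [e]; exact eq_refl hχ a)
  rwa [e] at this

open Classical in
/-- Simultaneous replacement of equals by equals. -/
theorem subst_congr {χ : Formula S Δ} {φ : Formula S Γ} (hχ : χ.IsGeometric)
    (hφ : φ.IsGeometric) {σ σ' : Subst Γ Δ}
    (he : ∀ s v, GeomDerivable T χ (.eq (σ s v) (σ' s v)))
    (h : GeomDerivable T χ (φ.subst σ)) : GeomDerivable T χ (φ.subst σ') := by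
  -- Induction on a list containing all variables at which `σ` and `σ'` may still differ.
  suffices H : ∀ (x : List (Σ s : S.Srt, Var Γ s)) (σ : Subst Γ Δ),
      (∀ s v, ⟨s, v⟩ ∉ x → σ s v = σ' s v) →
      (∀ s v, GeomDerivable T χ (.eq (σ s v) (σ' s v))) →
      GeomDerivable T χ (φ.subst σ) → GeomDerivable T χ (φ.subst σ') by
    obtain ⟨x, hx⟩ := Var.exists_list Γ
    exact H x σ (fun s v hv => absurd (hx s v) hv) he h
  intro x
  induction x with
  | nil =>
    intro σ hσ _ h
    have : σ = σ' := by funext s v; exact hσ s v List.not_mem_nil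
    rwa [← this]
  | cons p x ih =>
    intro σ hσ he h
    obtain ⟨r, w⟩ := p
    -- `υ` is `σ` with the entry at `w` made a fresh variable. Filling in `σ r w` returns `σ`;
    -- filling in `σ' r w` corrects that entry.
    let υ : Subst Γ (r :: Δ) := fun s v =>
      if e : (⟨s, v⟩ : Σ s : S.Srt, Var Γ s) = ⟨r, w⟩ then (show r = s from (congrArg Sigma.fst e).symm) ▸ .var .zero
      else (σ s v).subst (Subst.wk Δ r)
    have e₁ : υ.comp (Subst.cons (σ r w) (Subst.id Δ)) = σ := by
      funext s v
      by_cases e : (⟨s, v⟩ : Σ s : S.Srt, Var Γ s) = ⟨r, w⟩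
      · cases e
        simp only [Subst.comp, υ, dif_pos]; rfl
      · simp only [Subst.comp, υ, dif_neg e, Term.subst_subst]
        exact Term.subst_id _
    have e₂ : υ.comp (Subst.cons (σ' r w) (Subst.id Δ)) = fun s v =>
        if (⟨s, v⟩ : Σ s : S.Srt, Var Γ s) = ⟨r, w⟩ then σ' s v else σ s v := by
      funext s v
      by_cases e : (⟨s, v⟩ : Σ s : S.Srt, Var Γ s) = ⟨r, w⟩
      · cases e
        simp only [Subst.comp, υ, dif_pos, if_true]; rfl
      · simp only [Subst.comp, υ, dif_neg e, if_neg e, Term.subst_subst]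
        exact Term.subst_id _
    have h' := eq_replace (ψ := φ.subst υ) hχ (hφ.subst _) (he r w)
      (by rwa [Formula.subst_subst, e₁])
    rw [Formula.subst_subst, e₂] at h'
    refine ih _ (fun s v hv => ?_) (fun s v => ?_) h'
    · by_cases e : (⟨s, v⟩ : Σ s : S.Srt, Var Γ s) = ⟨r, w⟩
      · exact if_pos e
      · rw [if_neg e]
        exact hσ s v (by simp [e, hv])
    · by_cases e : (⟨s, v⟩ : Σ s : S.Srt, Var Γ s) = ⟨r, w⟩
      · rw [if_pos e]; exact eq_refl hχ _
      · rw [if_neg e]; exact he s v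

theorem of_varEqs {χ : Formula S Δ} (σ : Subst Γ Δ) (ρ : ∀ s : S.Srt, Var Γ s → Var Γ s)
    (x : List (Σ s : S.Srt, Var Γ s)) (h : GeomDerivable T χ ((Formula.varEqs ρ x).subst σ)) :
    ∀ s v, ⟨s, v⟩ ∈ x → GeomDerivable T χ (.eq (σ s v) (σ s (ρ s v))) := by
  induction x with
  | nil => intro s v hv; exact absurd hv List.not_mem_nil
  | cons p x ih =>
    intro s v hv
    have g := (Formula.isGeometric_varEqs ρ x).subst σ
    rcases List.mem_cons.1 hv with e | hv
    · subst e
      exact .cut h (.andL (L := .geometric) trivial g)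
    · exact ih (.cut h (.andR (L := .geometric) trivial g)) s v hv

end GeomDerivable

end Derivations

/-! ### Forcing conditions and relative double negation. -/

section Forcing

variable {S : Signature.{u}} {T : GeometricTheory S}

/-- The forcing conditions: a geometric hypothesis and a geometric goal in a common context. -/
structure World (T : GeometricTheory S) where
  /-- the context -/
  ctx : Ctx S
  /-- the hypothesis -/
  hyp : Formula S ctx
  /-- the goal -/
  goal : Formula S ctx
  hyp_geometric : hyp.IsGeometric
  goal_geometric : goal.IsGeometric

/-- The goal of the condition follows from its hypothesis in geometric logic. -/
def World.Provable (w : World T) : Prop := GeomDerivable T w.hyp w.goal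

/-- A refinement of forcing conditions: an instance of `w` with the same goal and a stronger
hypothesis. -/
@[ext]
structure World.Hom (q w : World T) where
  /-- the underlying substitution -/
  sub : Subst w.ctx q.ctx
  goal_eq : q.goal = w.goal.subst sub
  hyp_le : GeomDerivable T q.hyp (w.hyp.subst sub)

namespace World

/-- The identity refinement. -/
def Hom.id (w : World T) : Hom w w where
  sub := Subst.id _
  goal_eq := (Formula.subst_id _).symm
  hyp_le := by rw [Formula.subst_id]; exact .refl w.hyp_geometric

/-- Composition of refinements. -/
def Hom.comp {r q w : World T} (g : Hom r q) (f : Hom q w) : Hom r w where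
  sub := f.sub.comp g.sub
  goal_eq := by rw [g.goal_eq, f.goal_eq, Formula.subst_subst]
  hyp_le := by
    rw [← Formula.subst_subst]
    exact .cut g.hyp_le (.subst g.sub f.hyp_le)

theorem Hom.id_comp {q w : World T} (f : Hom q w) : (Hom.id q).comp f = f :=
  Hom.ext (Subst.comp_id _)

theorem Hom.comp_assoc {p r q w : World T} (h : Hom p r) (g : Hom r q) (f : Hom q w) :
    (h.comp g).comp f = h.comp (g.comp f) :=
  Hom.ext (Subst.comp_assoc _ _ _).symm

/-- Heredity of provability, needed for it to interpret `⊥`; it holds because the goal is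
substituted along with the hypothesis. -/
theorem Provable.restrict {q w : World T} (h : w.Provable) (f : Hom q w) : q.Provable := by
  unfold Provable
  rw [f.goal_eq]
  exact .cut f.hyp_le (.subst f.sub h)

/-- The condition `w` with `φ` added to its hypothesis. -/
def extend (w : World T) (φ : Formula S w.ctx) (hφ : φ.IsGeometric) : World T where
  ctx := w.ctx
  hyp := .and w.hyp φ
  goal := w.goal
  hyp_geometric := ⟨w.hyp_geometric, hφ⟩
  goal_geometric := w.goal_geometric

/-- The projection of `w.extend φ` to `w`. -/
def extendHom (w : World T) (φ : Formula S w.ctx) (hφ : φ.IsGeometric) :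
    Hom (w.extend φ hφ) w where
  sub := Subst.id _
  goal_eq := (Formula.subst_id _).symm
  hyp_le := (Formula.subst_id w.hyp).symm ▸ .andL w.hyp_geometric hφ

/-- The condition `w` with a new variable of sort `s`. -/
def weaken (w : World T) (s : S.Srt) : World T where
  ctx := s :: w.ctx
  hyp := w.hyp.wk s
  goal := w.goal.wk s
  hyp_geometric := w.hyp_geometric.subst _
  goal_geometric := w.goal_geometric.subst _

/-- The projection of `w.weaken s` to `w`. -/
def weakenHom (w : World T) (s : S.Srt) : Hom (w.weaken s) w where
  sub := Subst.wk _ s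
  goal_eq := rfl
  hyp_le := .refl (w.hyp_geometric.subst _)

/-- Double negation relative to provability of the goal. -/
def Locally (w : World T) (X : ∀ r : World T, Hom r w → Prop) : Prop :=
  ∀ (q : World T) (f : Hom q w), (∀ (r : World T) (g : Hom r q), X r (g.comp f) → r.Provable) →
    q.Provable

theorem Locally.restrict {q w : World T} {X : ∀ r : World T, Hom r w → Prop} (h : w.Locally X)
    (f : Hom q w) : q.Locally fun r g => X r (g.comp f) := by
  intro r g k
  exact h r (g.comp f) fun p e hp => k p e (show X p ((e.comp g).comp f) by rwa [Hom.comp_assoc])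

theorem Locally.of_forall {w : World T} {X : ∀ r : World T, Hom r w → Prop}
    (h : ∀ (r : World T) (f : Hom r w), X r f) : w.Locally X :=
  fun q _ k => k q (Hom.id q) (h _ _)

/-- The multiplication law of the continuation monad with answer type `Provable`. -/
theorem Locally.bind {w : World T} {X Y : ∀ r : World T, Hom r w → Prop} (h : w.Locally X)
    (hXY : ∀ (r : World T) (f : Hom r w), X r f → r.Locally fun q g => Y q (g.comp f)) :
    w.Locally Y := by
  intro q f k
  refine h q f fun r g hr => hXY r _ hr r (Hom.id r) fun p e hp => k p (e.comp g) ?_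
  rwa [Hom.comp_assoc]

theorem Locally.mono {w : World T} {X Y : ∀ r : World T, Hom r w → Prop} (h : w.Locally X)
    (hXY : ∀ (r : World T) (f : Hom r w), X r f → Y r f) : w.Locally Y :=
  fun q f k => h q f fun r g hr => k r g (hXY _ _ hr)

end World

/-! ### The forcing relation. -/

open World

/-- The hypothesis of `w` entails the instance `φ[σ]`. -/
def Entails {Γ : Ctx S} (w : World T) (σ : Subst Γ w.ctx) (φ : Formula S Γ) : Prop :=
  GeomDerivable T w.hyp (φ.subst σ)

/-- The condition `w` forces the instance `φ[σ]` of an infinitary first-order formula. -/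
def Forces : ∀ {Γ : Ctx S} (w : World T) (_ : Subst Γ w.ctx) (_ : Formula S Γ), Prop
  | _, w, σ, .eq a b => w.Locally fun r f => Entails r (σ.comp f.sub) (.eq a b)
  | _, w, σ, .rel R a => w.Locally fun r f => Entails r (σ.comp f.sub) (.rel R a)
  | _, _, _, .top => True
  -- With `⊥` read this way, `¬φ` says that every refinement forcing `φ` proves its goal.
  | _, w, _, .bot => w.Provable
  | _, w, σ, .and φ ψ => Forces w σ φ ∧ Forces w σ ψ
  | _, w, σ, .or φ ψ =>
    w.Locally fun r f => Forces r (σ.comp f.sub) φ ∨ Forces r (σ.comp f.sub) ψ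
  | _, w, σ, .imp φ ψ =>
    ∀ (q : World T) (f : Hom q w), Forces q (σ.comp f.sub) φ → Forces q (σ.comp f.sub) ψ
  | _, w, σ, .iOr φ => w.Locally fun r f => ∃ i, Forces r (σ.comp f.sub) (φ i)
  | _, w, σ, .iAnd φ => ∀ i, Forces w σ (φ i)
  | _, w, σ, .ex φ => w.Locally fun r f => ∃ t, Forces r (Subst.cons t (σ.comp f.sub)) φ
  | _, w, σ, .all φ =>
    ∀ (q : World T) (f : Hom q w) (t : Term S q.ctx _), Forces q (Subst.cons t (σ.comp f.sub)) φ

theorem comp_sub_comp {Γ : Ctx S} {r q w : World T} (σ : Subst Γ w.ctx) (g : Hom r q)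
    (f : Hom q w) : σ.comp (g.comp f).sub = (σ.comp f.sub).comp g.sub :=
  (Subst.comp_assoc _ _ _).symm

theorem comp_sub_id {Γ : Ctx S} {w : World T} (σ : Subst Γ w.ctx) :
    σ.comp (Hom.id w).sub = σ :=
  Subst.comp_id _

theorem Entails.restrict {Γ : Ctx S} {q w : World T} {σ : Subst Γ w.ctx} {φ : Formula S Γ}
    (h : Entails w σ φ) (f : Hom q w) : Entails q (σ.comp f.sub) φ := by
  unfold Entails
  rw [← Formula.subst_subst]
  exact .cut f.hyp_le (.subst f.sub h)

theorem Forces.restrict {Γ : Ctx S} {q w : World T} {σ : Subst Γ w.ctx} {φ : Formula S Γ}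
    (h : Forces w σ φ) (f : Hom q w) : Forces q (σ.comp f.sub) φ := by
  induction φ generalizing q w with
  | eq | rel | or | iOr | ex =>
    simp only [Forces] at h ⊢
    simpa only [comp_sub_comp] using h.restrict f
  | top => trivial
  | bot => exact Provable.restrict h f
  | and φ ψ ihφ ihψ => exact ⟨ihφ h.1 f, ihψ h.2 f⟩
  | imp φ ψ _ _ =>
    intro r g
    rw [← comp_sub_comp]
    exact h r (g.comp f)
  | iAnd φ ih => exact fun i => ih i (h i) f
  | all φ _ =>
    intro r g
    rw [← comp_sub_comp]
    exact h r (g.comp f)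

/-- Forcing is local for relative double negation. -/
theorem Forces.of_locally {Γ : Ctx S} {w : World T} {σ : Subst Γ w.ctx} {φ : Formula S Γ}
    (h : w.Locally fun r f => Forces r (σ.comp f.sub) φ) : Forces w σ φ := by
  induction φ generalizing w with
  | eq | rel | or | iOr | ex =>
    simp only [Forces] at h ⊢
    refine h.bind fun r f hr => ?_
    simpa only [comp_sub_comp] using hr
  | top => trivial
  | bot => exact h w (Hom.id w) fun r g hr => hr
  | and φ ψ ihφ ihψ =>
    exact ⟨ihφ (h.mono fun r f hr => hr.1), ihψ (h.mono fun r f hr => hr.2)⟩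
  | imp φ ψ ihφ ihψ =>
    intro q f hq
    refine ihψ ((h.restrict f).mono fun r g hr => ?_)
    have := hr r (Hom.id r)
    rw [comp_sub_id, comp_sub_comp] at this
    exact this (hq.restrict g)
  | iAnd φ ih => exact fun i => ih i (h.mono fun r f hr => hr i)
  | all φ ih =>
    intro q f t
    refine ih ((h.restrict f).mono fun r g hr => ?_)
    have := hr r (Hom.id r) (t.subst g.sub)
    rw [comp_sub_id, comp_sub_comp] at this
    rwa [Subst.cons_comp]

/-- Ex falso: over a provable condition every property holds locally. -/
theorem Forces.of_provable {Γ : Ctx S} {w : World T} (h : w.Provable) (σ : Subst Γ w.ctx)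
    (φ : Formula S Γ) : Forces w σ φ :=
  Forces.of_locally fun _ f _ => h.restrict f

theorem Forces.elim {Γ : Ctx S} {w : World T} {σ : Subst Γ w.ctx} {φ : Formula S Γ}
    {X : ∀ r : World T, Hom r w → Prop} (h : w.Locally X)
    (hX : ∀ (r : World T) (f : Hom r w), X r f → Forces r (σ.comp f.sub) φ) : Forces w σ φ :=
  Forces.of_locally (h.mono hX)

theorem forces_subst {Γ Δ : Ctx S} (φ : Formula S Γ) (ρ : Subst Γ Δ) (w : World T)
    (σ : Subst Δ w.ctx) : Forces w σ (φ.subst ρ) ↔ Forces w (ρ.comp σ) φ := by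
  induction φ generalizing Δ w <;>
    simp_all only [Forces, Formula.subst, Entails, Term.subst_subst, Subst.comp_assoc,
      Subst.lift_comp_cons]

theorem forces_wk {Γ : Ctx S} {s : S.Srt} (φ : Formula S Γ) (w : World T)
    (σ : Subst (s :: Γ) w.ctx) :
    Forces w σ (φ.wk s) ↔ Forces w ((Subst.wk Γ s).comp σ) φ :=
  forces_subst _ _ _ _

/-- Extends `subst_congr` from atoms to all infinitary formulas, as soundness of the equality rule
requires. -/
theorem Forces.congr {Γ : Ctx S} {w : World T} {σ σ' : Subst Γ w.ctx} {φ : Formula S Γ}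
    (he : ∀ s v, GeomDerivable T w.hyp (.eq (σ s v) (σ' s v))) (h : Forces w σ φ) :
    Forces w σ' φ := by
  have restr : ∀ {Γ : Ctx S} {w : World T} {σ σ' : Subst Γ w.ctx},
      (∀ s v, GeomDerivable T w.hyp (.eq (σ s v) (σ' s v))) → ∀ (q : World T) (f : Hom q w) s v,
      GeomDerivable T q.hyp (.eq (σ.comp f.sub s v) (σ'.comp f.sub s v)) :=
    fun he q f s v => .cut f.hyp_le (.subst f.sub (he s v))
  have cons : ∀ {Γ : Ctx S} {w : World T} {σ σ' : Subst Γ w.ctx} {s : S.Srt} (t : Term S w.ctx s),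
      (∀ s v, GeomDerivable T w.hyp (.eq (σ s v) (σ' s v))) →
      ∀ r v, GeomDerivable T w.hyp (.eq (Subst.cons t σ r v) (Subst.cons t σ' r v)) := by
    intro Γ w σ σ' s t he r v
    cases v with
    | zero => exact GeomDerivable.eq_refl w.hyp_geometric t
    | succ v => exact he r v
  induction φ generalizing w with
  | eq | rel =>
    refine Locally.mono h fun r f hr =>
      GeomDerivable.subst_congr r.hyp_geometric ?_ (restr he r f) hr
    trivial
  | top => trivial
  | bot => exact h
  | and φ ψ ihφ ihψ => exact ⟨ihφ he h.1, ihψ he h.2⟩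
  | or φ ψ ihφ ihψ =>
    exact Locally.mono h fun r f hr => hr.imp (ihφ (restr he r f)) (ihψ (restr he r f))
  | imp φ ψ ihφ ihψ =>
    -- The premise of `⇒` is contravariant, hence the use of symmetry.
    exact fun q f hq => ihψ (restr he q f)
      (h q f (ihφ (restr (fun s v => GeomDerivable.eq_symm w.hyp_geometric (he s v)) q f) hq))
  | iOr φ ih => exact Locally.mono h fun r f ⟨i, hr⟩ => ⟨i, ih i (restr he r f) hr⟩
  | iAnd φ ih => exact fun i => ih i he (h i)
  | ex φ ih => exact Locally.mono h fun r f ⟨t, hr⟩ => ⟨t, ih (cons t (restr he r f)) hr⟩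
  | all φ ih => exact fun q f t => ih (cons t (restr he q f)) (h q f t)

/-- A geometric instance is locally entailed iff it may be assumed when proving the goal. -/
theorem locally_of_entails {Γ : Ctx S} {w : World T} {σ : Subst Γ w.ctx} {φ : Formula S Γ}
    (hφ : φ.IsGeometric) {X : ∀ r : World T, Hom r w → Prop}
    (h : w.Locally fun r f => Entails r (σ.comp f.sub) φ)
    (hX : ∀ (q : World T) (f : Hom q w),
      (∀ (r : World T) (g : Hom r q), X r (g.comp f) → r.Provable) →
        (q.extend (φ.subst (σ.comp f.sub)) (hφ.subst _)).Provable) : w.Locally X := by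
  intro q f k
  refine h q f fun r g hr => ?_
  unfold Entails at hr
  -- The extended condition proves the goal of `q`; at `r` the added assumption is already entailed
  -- and can be cut away.
  have key := Derivable.subst g.sub (hX q f k)
  unfold Provable
  rw [g.goal_eq]
  refine .cut (.andI g.hyp_le ?_) key
  rwa [Formula.subst_subst, ← comp_sub_comp]

/-- For geometric formulas, forcing is local entailment. -/
theorem forces_iff_locally_entails {Γ : Ctx S} {φ : Formula S Γ} (hφ : φ.IsGeometric) (w : World T)
    (σ : Subst Γ w.ctx) :
    Forces w σ φ ↔ w.Locally fun r f => Entails r (σ.comp f.sub) φ := by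
  have ext : ∀ {Γ : Ctx S} {φ : Formula S Γ} (hφ : φ.IsGeometric) (q : World T)
      (σ : Subst Γ q.ctx), Entails (q.extend (φ.subst σ) (hφ.subst _))
        (σ.comp (q.extendHom (φ.subst σ) (hφ.subst _)).sub) φ := by
    intro Γ φ hφ q σ
    have : σ.comp (q.extendHom (φ.subst σ) (hφ.subst _)).sub = σ := Subst.comp_id σ
    rw [this]
    exact .andR q.hyp_geometric (hφ.subst _)
  have loc : ∀ {Γ : Ctx S} {φ : Formula S Γ} {q : World T} {σ : Subst Γ q.ctx},
      Entails q σ φ → q.Locally fun r f => Entails r (σ.comp f.sub) φ :=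
    fun h => Locally.of_forall fun r f => h.restrict f
  induction φ generalizing w with
  | eq | rel => exact Iff.rfl
  | top => exact ⟨fun _ => Locally.of_forall fun r f => .topI r.hyp_geometric, fun _ => trivial⟩
  | bot =>
    refine ⟨fun h q f _ => Provable.restrict h f, fun h => ?_⟩
    exact h w (Hom.id w) fun r g hr => .cut hr (.botE r.goal_geometric)
  | and φ ψ ihφ ihψ =>
    have g := fun {Δ : Ctx S} (τ : Subst _ Δ) => And.intro (hφ.1.subst τ) (hφ.2.subst τ)
    simp only [Forces, ihφ hφ.1, ihψ hφ.2]
    constructor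
    · rintro ⟨h₁, h₂⟩
      refine h₁.bind fun r f hr => (h₂.restrict f).mono fun q e hq => ?_
      have := hr.restrict e
      rw [← comp_sub_comp] at this
      exact .andI this hq
    · intro h
      exact ⟨h.mono fun r f hr => .cut hr (.andL (g _).1 (g _).2),
        h.mono fun r f hr => .cut hr (.andR (g _).1 (g _).2)⟩
  | or φ ψ ihφ ihψ =>
    simp only [Forces, ihφ hφ.1, ihψ hφ.2]
    constructor
    · intro h
      refine h.bind fun r f hr => ?_
      simp only [comp_sub_comp]
      rcases hr with hr | hr
      · exact hr.mono fun q g hq => .cut hq (.orL (hφ.1.subst _) (hφ.2.subst _))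
      · exact hr.mono fun q g hq => .cut hq (.orR (hφ.1.subst _) (hφ.2.subst _))
    · intro h
      -- By `k`, adding either disjunct to the hypothesis of `q` gives a provable condition; case
      -- distinction combines the two.
      refine locally_of_entails hφ h fun q f k => ?_
      refine GeomDerivable.or_cases q.hyp_geometric q.goal_geometric (hφ.1.subst _)
        (hφ.2.subst _) ?_ ?_
      · refine k _ (q.extendHom _ (hφ.1.subst _)) (Or.inl ?_)
        rw [comp_sub_comp]
        exact loc (ext hφ.1 q _)
      · refine k _ (q.extendHom _ (hφ.2.subst _)) (Or.inr ?_)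
        rw [comp_sub_comp]
        exact loc (ext hφ.2 q _)
  | iOr φ ih =>
    simp only [Forces, fun i => ih i (hφ i)]
    constructor
    · intro h
      refine h.bind fun r f hr => ?_
      simp only [comp_sub_comp]
      obtain ⟨i, hr⟩ := hr
      exact hr.mono fun q g hq =>
        .cut hq (.iOrI (L := .geometric) (fun i => (hφ i).subst _) i)
    · intro h
      refine locally_of_entails hφ h fun q f k => ?_
      refine GeomDerivable.iOr_cases q.hyp_geometric q.goal_geometric
        (fun i => (hφ i).subst _) fun i => ?_
      refine k _ (q.extendHom _ ((hφ i).subst _)) ⟨i, ?_⟩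
      rw [comp_sub_comp]
      exact loc (ext (hφ i) q _)
  | @ex _ s φ ih =>
    simp only [Forces, ih hφ]
    constructor
    · intro h
      refine h.bind fun r f hr => ?_
      simp only [comp_sub_comp]
      obtain ⟨t, hr⟩ := hr
      refine hr.mono fun q g hq => ?_
      have key := GeomDerivable.ex_intro (T := T)
        (Formula.IsGeometric.subst (φ := φ) hφ (((σ.comp f.sub).comp g.sub).lift _)) (t.subst g.sub)
      rw [Formula.subst_subst, Subst.lift_comp_cons, Subst.comp_id, ← Subst.cons_comp] at key
      exact .cut hq key
    · intro h
      refine locally_of_entails hφ h fun q f k => ?_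
      refine GeomDerivable.ex_cases q.hyp_geometric q.goal_geometric
        (Formula.IsGeometric.subst (φ := φ) hφ _) ?_
      -- The generic witness: a fresh variable of sort `s`, with `φ` assumed of it.
      refine k ((q.weaken s).extend _ (Formula.IsGeometric.subst (φ := φ) hφ _))
        (((q.weaken s).extendHom _ (Formula.IsGeometric.subst (φ := φ) hφ _)).comp (q.weakenHom s))
        ⟨.var .zero, loc ?_⟩
      have e : Subst.cons (.var .zero)
          (σ.comp (f.sub.comp ((Subst.wk q.ctx s).comp (Subst.id (s :: q.ctx))))) =
            (σ.comp f.sub).lift s := by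
        rw [Subst.comp_id, Subst.lift_eq_cons, Subst.comp_assoc]
      exact e ▸ .andR (q.weaken s).hyp_geometric (Formula.IsGeometric.subst (φ := φ) hφ _)
  | imp | iAnd | all => exact hφ.elim

/-- Classical derivations are sound for forcing. -/
theorem Derivable.forces {L : Logic} {Γ : Ctx S} {φ ψ : Formula S Γ} (h : Derivable T L φ ψ)
    (w : World T) (σ : Subst Γ w.ctx) (hw : Forces w σ φ) : Forces w σ ψ := by
  induction h generalizing w with
  | ax s hs =>
    -- Both sides being geometric, forcing is local entailment, to which the axiom applies by cut.
    have g := T.geometric s hs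
    rw [forces_iff_locally_entails g.1] at hw
    rw [forces_iff_locally_entails g.2]
    exact hw.mono fun r f hr => .cut hr (.subst _ (.ax s hs))
  | refl => exact hw
  | cut _ _ ih₁ ih₂ => exact ih₂ w σ (ih₁ w σ hw)
  | subst τ _ ih =>
    rw [forces_subst] at hw ⊢
    exact ih w _ hw
  | topI => trivial
  | andL => exact hw.1
  | andR => exact hw.2
  | andI _ _ ih₁ ih₂ => exact ⟨ih₁ w σ hw, ih₂ w σ hw⟩
  | botE => exact Forces.of_provable hw σ _
  | orL => exact Locally.of_forall fun r f => Or.inl (hw.restrict f)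
  | orR => exact Locally.of_forall fun r f => Or.inr (hw.restrict f)
  | orE _ _ ih₁ ih₂ => exact Forces.elim hw fun r f hr => hr.elim (ih₁ r _) (ih₂ r _)
  | iOrI _ i => exact Locally.of_forall fun r f => ⟨i, hw.restrict f⟩
  | iOrE _ _ ih => exact Forces.elim hw fun r f ⟨i, hr⟩ => ih i r _ hr
  | exE _ _ ih =>
    exact Forces.elim hw fun r f ⟨t, hr⟩ => (forces_wk _ _ _).1 (ih r _ hr)
  | exI _ ih =>
    refine (forces_wk _ _ _).2 (ih w _ (Locally.of_forall fun r f => ?_))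
    -- The witness is the value already assigned to the bound variable.
    refine ⟨σ.comp f.sub _ .zero, ?_⟩
    rw [Subst.comp_assoc, Subst.cons_eta]
    exact hw.restrict f
  | iOrDistrib => exact Locally.mono hw.1 fun r f ⟨i, hr⟩ => ⟨i, hr, hw.2.restrict f⟩
  | exDistrib =>
    exact Locally.mono hw.1 fun r f ⟨t, hr⟩ => ⟨t, hr, (forces_wk _ _ _).2 (hw.2.restrict f)⟩
  | eqRefl => exact Locally.of_forall fun r f => GeomDerivable.eq_refl r.hyp_geometric _
  | eqSubst _ x ρ hρ =>
    refine Forces.elim ((forces_iff_locally_entails (Formula.isGeometric_varEqs ρ x) w σ).1 hw.1)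
      fun r f hr => (forces_subst _ _ _ _).2 (Forces.congr (fun s v => ?_) (hw.2.restrict f))
    by_cases hv : ⟨s, v⟩ ∈ x
    · exact GeomDerivable.of_varEqs _ ρ x hr s v hv
    · simp only [Subst.comp, Term.subst, hρ s v hv]
      exact GeomDerivable.eq_refl r.hyp_geometric _
  | iAndE _ i => exact hw i
  | iAndI _ _ ih => exact fun i => ih i w σ hw
  | impI _ _ ih => exact fun q f hq => ih q _ ⟨hw.restrict f, hq⟩
  | impE _ _ ih =>
    have := ih w σ hw.1 w (Hom.id w)
    rw [comp_sub_id] at this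
    exact this hw.2
  | allI _ _ ih => exact fun q f t => ih q _ ((forces_wk _ _ _).2 (hw.restrict f))
  | allE _ _ ih =>
    have := ih w _ ((forces_wk _ _ _).1 hw) w (Hom.id w) (σ _ .zero)
    rwa [comp_sub_id, Subst.cons_eta] at this
  | lem _ φ =>
    -- By `k`, any refinement of `q` forcing `φ` is provable. So `q` forces `¬φ`, and `k` at `q`
    -- itself makes `q` provable.
    intro q f k
    refine k q (Hom.id q) (Or.inr fun r g hr => k r g (Or.inl ?_))
    rwa [Hom.id_comp, ← comp_sub_comp] at hr

/-- Geometric sequents derivable in a stronger logic are derivable in geometric logic. -/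
theorem Derivable.geometric {L : Logic} {Γ : Ctx S} {φ ψ : Formula S Γ} (hφ : φ.IsGeometric)
    (hψ : ψ.IsGeometric) (h : Derivable T L φ ψ) : Derivable T .geometric φ ψ := by
  let w : World T := ⟨Γ, φ, ψ, hφ, hψ⟩
  have h₁ : Forces w (Subst.id Γ) φ :=
    (forces_iff_locally_entails hφ w _).2 (Locally.of_forall fun r f => f.hyp_le)
  have h₂ := (forces_iff_locally_entails hψ w _).1 (h.forces w _ h₁)
  -- The goal of `r` is the instance of `ψ` along `g`, so entailing that instance is proving the
  -- goal.
  refine h₂ w (Hom.id w) fun r g hr => ?_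
  unfold Provable
  rw [g.goal_eq]
  exact hr

end Forcing

end GeometricLogic

theorem mainTheorem3 {S : GeometricLogic.Signature.{u}}
    (T : GeometricLogic.GeometricTheory S)
    (σ : GeometricLogic.Sequent S) (hσ : σ.IsGeometric) :
    List.TFAE
      [T.Derives GeometricLogic.Logic.geometric σ,
       T.Derives GeometricLogic.Logic.intuitionistic σ,
       T.Derives GeometricLogic.Logic.classical σ] := by
  tfae_have 1 → 2 := GeometricLogic.Derivable.mono (by simp) (by simp)
  tfae_have 2 → 3 := GeometricLogic.Derivable.mono (by simp) (by simp)
  tfae_have 3 → 1 := GeometricLogic.Derivable.geometric hσ.1 hσ.2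
  tfae_finish
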